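/- **Parameters.** Let $\mathbf N$ be the set of tuples $\mathbf n=(T,\mathrm{nor},\bar\lambda,\bar\mu)$ such that: - (a) $T$ is a subtree of $\omega^{<\omega}$ (a nonempty set of finite sequences closed under initial segments); write $\mathrm{suc}_T(\eta)=\{\eta^\frown m: \eta^\frown m\in T\}$ and $\lg(\eta)$ for the length of $\eta$. - (b) $\bar\mu=(\mu_\eta:\eta\in T)$ is a sequence of non-negative reals. - (c) $\bar\lambda=(\lambda_\eta:\eta\in T)$ is a sequence of pairwise distinct non-zero natural numbers with $\lambda_\eta=\{m:\eta^\frown m\in T\}$ (so the immediate successors of $\eta$ are the $\eta^\frown m$ with $m<\lambda_\eta$), and: if $\lg(\eta)=\lg(\nu)$ and $\eta<_{lex}\nu$ then $\lambda_\eta<\lambda_\nu$; if $\lg(\eta)<\lg(\nu)$ then $\lg(\eta)<\lambda_\eta<\lambda_\nu$; and $\lg(\eta)<\mu_\eta<\lambda_\eta$ for all $\eta\in T$. - (d) For $\eta\in T$, $\mathrm{nor}_\eta$ assigns to each nonempty $X\subseteq\mathrm{suc}_T(\eta)$ a non-negative real, monotonically in $X$, and $(\lg(\eta)+1)^2\le\mu_\eta\le\mathrm{nor}_\eta(\mathrm{suc}_T(\eta))$.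 - (e) $\prod\{\lambda_\nu:\nu\in T,\ \lambda_\nu<\lambda_\eta\}<\mu_\eta$ for $\eta\in T$. - (f) (Co-bigness) If $k>0$ is real, $1\le i_*\le\mu_\eta$ is an integer, and $a_i\subseteq\mathrm{suc}_T(\eta)$ is nonempty with $k+\frac1{\mu_\eta}\le\mathrm{nor}_\eta(a_i)$ for every $i<i_*$, then $\bigcap_{i<i_*}a_i\neq\emptyset$ and $k\le\mathrm{nor}_\eta(\bigcap_{i<i_*}a_i)$. - (g) If $\emptyset\ne a\subseteq\mathrm{suc}_T(\eta)$ and $1\le\mathrm{nor}_\eta(a)$, then $\frac12<|a|/|\mathrm{suc}_T(\eta)|$. - (h) If $k>0$ is real, $a\subseteq\mathrm{suc}_T(\eta)$, $\rho\in a$ and $k+\mu_\eta\le\mathrm{nor}_\eta(a)$, then $a\setminus\{\rho\}\ne\emptyset$ and $k\le\mathrm{nor}_\eta(a\setminus\{\rho\})$. **The forcing.** For $\mathbf n\in\mathbf N$, a condition $p\in\mathbb Q^2_{\mathbf n}$ consists of a trunk $\mathrm{tr}(p)\in T$, a perfect subtree $T_p\subseteq T$ that contains $\mathrm{tr}(p)$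 and all of whose nodes are comparable with $\mathrm{tr}(p)$, and a natural number $n\in[1,\lg(\mathrm{tr}(p))+1]$ such that $1+\frac1n\le\mathrm{nor}_\eta(\mathrm{suc}_{T_p}(\eta))$ for every $\eta\in T_p$ extending or equal to $\mathrm{tr}(p)$. A condition $q$ is stronger than $p$ iff $T_q\subseteq T_p$. **Claim.** For every $\mathbf n\in\mathbf N$, the forcing $\mathbb Q^2_{\mathbf n}$ does not add a dominating real: there are no condition $p$ and no $\mathbb Q^2_{\mathbf n}$-name $g$ such that $p$ forces that $g\in\omega^\omega$ and that, for every $f\in\omega^\omega$ in the ground model, $f(n)\le g(n)$ for all but finitely many $n$. -/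

import Mathlib

/-! ### Trees of finite sequences of natural numbers

Finite sequences are lists; `η <+: ν` says that `η` is an initial segment of `ν`, and
`η ++ [m]` is `η` followed by `m`. -/

/-- A subtree of `ω^{<ω}`: a nonempty set of finite sequences closed under initial segments. -/
def IsSubtree (T : Set (List ℕ)) : Prop :=
  T.Nonempty ∧ ∀ η ν : List ℕ, η <+: ν → ν ∈ T → η ∈ T

/-- The set of immediate successors of `η` in `T`. -/
def treeSuc (T : Set (List ℕ)) (η : List ℕ) : Set (List ℕ) :=
  {ν | ν ∈ T ∧ ∃ m : ℕ, ν = η ++ [m]}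

/-- A perfect tree: a subtree of `ω^{<ω}` in which every node has two incomparable extensions. -/
def IsPerfectTree (T : Set (List ℕ)) : Prop :=
  IsSubtree T ∧ ∀ η ∈ T, ∃ ν₁ ∈ T, ∃ ν₂ ∈ T,
    η <+: ν₁ ∧ η <+: ν₂ ∧ ¬ ν₁ <+: ν₂ ∧ ¬ ν₂ <+: ν₁

/-- The subtree of the nodes of `T` that are comparable with `η`. -/
def treeAbove (T : Set (List ℕ)) (η : List ℕ) : Set (List ℕ) :=
  {ν | ν ∈ T ∧ (ν <+: η ∨ η <+: ν)}

/-! ### The parameters -/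

/-- The parameters `𝐧 = (T, nor, λ, μ)`. The functions `nor`, `lam`, `mu` matter only at nodes
of `T`, and `nor η` only at nonempty subsets of `treeSuc T η`; an inequality `k ≤ nor η a`
in a conclusion includes that `a` is nonempty. The relation "much smaller" is only required to
mean "smaller", so that the parameters for every stricter reading of it are among these. -/
structure CreatureParam where
  T : Set (List ℕ)
  nor : List ℕ → Set (List ℕ) → ℝ
  lam : List ℕ → ℕ
  mu : List ℕ → ℝ
  subtree : IsSubtree T
  mu_nonneg : ∀ η ∈ T, 0 ≤ mu η
  lam_injOn : Set.InjOn lam T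
  lam_ne_zero : ∀ η ∈ T, lam η ≠ 0
  /-- `λ_η = {m : η ⌢ m ∈ T}`, where a natural number is the set of the smaller ones. -/
  lam_spec : ∀ η ∈ T, ∀ m : ℕ, η ++ [m] ∈ T ↔ m < lam η
  lam_lex : ∀ η ∈ T, ∀ ν ∈ T, η.length = ν.length → List.Lex (· < ·) η ν → lam η < lam ν
  lam_length : ∀ η ∈ T, ∀ ν ∈ T, η.length < ν.length → η.length < lam η ∧ lam η < lam ν
  length_lt_mu : ∀ η ∈ T, (η.length : ℝ) < mu η
  mu_lt_lam : ∀ η ∈ T, mu η < (lam η : ℝ)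
  nor_nonneg : ∀ η ∈ T, ∀ a ⊆ treeSuc T η, a.Nonempty → 0 ≤ nor η a
  nor_mono : ∀ η ∈ T, ∀ a b : Set (List ℕ), a ⊆ b → b ⊆ treeSuc T η → a.Nonempty →
    nor η a ≤ nor η b
  sq_le_mu : ∀ η ∈ T, ((η.length : ℝ) + 1) ^ 2 ≤ mu η
  mu_le_nor : ∀ η ∈ T, mu η ≤ nor η (treeSuc T η)
  /-- The product is over a finite set, because `lam` is injective on `T`. -/
  prod_lt_mu : ∀ η ∈ T, (∏ᶠ ν ∈ {ν | ν ∈ T ∧ lam ν < lam η}, (lam ν : ℝ)) < mu η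
  /-- Co-bigness. -/
  co_big : ∀ η ∈ T, ∀ k : ℝ, 0 < k → ∀ i : ℕ, 0 < i → (i : ℝ) ≤ mu η →
    ∀ a : Fin i → Set (List ℕ),
      (∀ j, a j ⊆ treeSuc T η ∧ (a j).Nonempty ∧ k + 1 / mu η ≤ nor η (a j)) →
      (⋂ j, a j).Nonempty ∧ k ≤ nor η (⋂ j, a j)
  half_lt : ∀ η ∈ T, ∀ a ⊆ treeSuc T η, a.Nonempty → 1 ≤ nor η a →
    (1 : ℝ) / 2 < (a.ncard : ℝ) / ((treeSuc T η).ncard : ℝ)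
  nor_diff : ∀ η ∈ T, ∀ k : ℝ, 0 < k → ∀ a ⊆ treeSuc T η, ∀ ρ ∈ a, k + mu η ≤ nor η a →
    (a \ {ρ}).Nonempty ∧ k ≤ nor η (a \ {ρ})

/-! ### The forcing notion -/

/-- The conditions of the forcing notion `ℚ²_𝐧`. -/
structure QTwo (c : CreatureParam) where
  trunk : List ℕ
  tree : Set (List ℕ)
  n : ℕ
  trunk_mem : trunk ∈ tree
  perfect : IsPerfectTree tree
  tree_subset : tree ⊆ treeAbove c.T trunk
  one_le : 1 ≤ n
  n_le : n ≤ trunk.length + 1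
  le_nor : ∀ η ∈ tree, trunk <+: η → (treeSuc tree η).Nonempty ∧
    1 + 1 / (n : ℝ) ≤ c.nor η (treeSuc tree η)

/-- Reverse inclusion of trees: `p ≤ q` says that `q` is the stronger condition. -/
instance (c : CreatureParam) : Preorder (QTwo c) where
  le p q := q.tree ⊆ p.tree
  le_refl p := Set.Subset.refl p.tree
  le_trans _ _ _ h₁ h₂ := Set.Subset.trans h₂ h₁

/-! ### Names of reals and the forcing relation

Throughout, `p ≤ q` means that `q` is stronger than `p`. A sentence of the forcing language is
represented by the set of the conditions that force it, and the logical operations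
are the usual recursive clauses of the forcing relation. -/

namespace Forcing

variable {P : Type*} [Preorder P]

/-- `p ⊩ ∀ x, φ x`, where `x` ranges over a set of the ground model. -/
def all {X : Type*} (φ : X → P → Prop) (p : P) : Prop := ∀ x, φ x p

/-- `p ⊩ ∃ x, φ x`, where `x` ranges over a set of the ground model: the conditions that force
some `φ x` are dense above `p`. -/
def ex {X : Type*} (φ : X → P → Prop) (p : P) : Prop :=
  ∀ q, p ≤ q → ∃ r, q ≤ r ∧ ∃ x, φ x r

/-- `p ⊩ φ ∧ ψ`. -/
def and (φ ψ : P → Prop) (p : P) : Prop := φ p ∧ ψ p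

/-- `p ⊩ φ → ψ`. -/
def imp (φ ψ : P → Prop) (p : P) : Prop := ∀ q, p ≤ q → φ q → ψ q

/-- `p ⊩ A`, where `A` is a statement about elements of the ground model. -/
def ground (A : Prop) (_ : P) : Prop := A

/-- `P`-names of subsets of `ω × ω`: sets of pairs `((n, m), s)`, where `(n, m)` stands for its
canonical name and `s` is a condition. Every subset of `ω × ω` in a generic extension has
such a name. -/
abbrev Name (P : Type*) := Set ((ℕ × ℕ) × P)

/-- `p ⊩ (n, m) ∈ g`. -/
def mem (g : Name P) (n m : ℕ) (p : P) : Prop :=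
  ∀ q, p ≤ q → ∃ r, q ≤ r ∧ ∃ s, ((n, m), s) ∈ g ∧ s ≤ r

/-- `p ⊩ g ∈ ω^ω`. -/
def isReal (g : Name P) : P → Prop :=
  and (all fun n => ex fun m => mem g n m)
    (all fun n => all fun m => all fun m' =>
      imp (and (mem g n m) (mem g n m')) (ground (m = m')))

/-- `p ⊩ f ≤* g`, for `f ∈ ω^ω` in the ground model: `f n ≤ g n` for all but finitely many
`n`. -/
def dominates (g : Name P) (f : ℕ → ℕ) : P → Prop :=
  ex fun N : ℕ => all fun n : ℕ => all fun m : ℕ =>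
    imp (and (ground (N ≤ n)) (mem g n m)) (ground (f n ≤ m))

/-- Some condition forces that some real of the extension dominates every real of the
ground model. -/
def AddsDominatingReal (P : Type*) [Preorder P] : Prop :=
  ∃ (p : P) (g : Name P), isReal g p ∧ all (fun f : ℕ → ℕ => dominates g f) p

end Forcing

/-!
Call a set `A` of conditions Fréchet-linked if every sequence in `A` has a condition forcing that
infinitely many of its terms lie in the generic filter. Given a name `g` of a real and `k : ℕ`, the
conditions in `A` cannot force arbitrarily large lower bounds on `g k`: a limit of a sequence of
conditions doing so would leave no possible value for `g k`. If countably many Fréchet-linked sets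
cover the forcing, then diagonalizing over the resulting bounds yields a ground model real that
cannot be forced to be dominated by `g`.

In `ℚ²_𝐧` the conditions with a given trunk are Fréchet-linked. Since the tree `T` is finitely
branching, the limit inferior of the trees of a sequence along an ultrafilter has, at each node,
the successor set of almost all trees of the sequence, so it is again the tree of a condition. Any
stronger condition shares a node well above the trunk with almost all conditions of the sequence,
and co-bigness makes two conditions with such a common node compatible.
-/

open Filter

theorem one_div_add_one_add_one_div_sq_le {K : Type*} [Field K] [LinearOrder K]
    [IsStrictOrderedRing K] {x : K} (hx : 0 < x) :
    1 / (x + 1) + 1 / (x + 1) ^ 2 ≤ 1 / x := by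
  rw [div_add_div _ _ (by positivity) (by positivity),
    div_le_div_iff₀ (by positivity) (by positivity)]
  nlinarith

theorem exists_forall_eventually_le {ι α : Type*} [Countable ι] [SemilatticeSup α] [OrderBot α]
    (B : ι → ℕ → α) : ∃ f : ℕ → α, ∀ i, ∀ᶠ k in atTop, B i k ≤ f k := by
  cases isEmpty_or_nonempty ι
  · exact ⟨fun _ => ⊥, isEmptyElim⟩
  obtain ⟨e, he⟩ := exists_surjective_nat ι
  refine ⟨fun k => (Finset.range (k + 1)).sup fun n => B (e n) k, he.forall.2 fun n => ?_⟩
  filter_upwards [eventually_ge_atTop n] with k hk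
  exact Finset.le_sup (f := fun n => B (e n) k) (Finset.mem_range_succ_iff.2 hk)

theorem eventually_inter_liminf_eq {ι α : Type*} (U : Ultrafilter ι) (S : ι → Set α)
    {A : Set α} (hA : A.Finite) : ∀ᶠ i in U, A ∩ liminf S U = A ∩ S i := by
  have hiff : ∀ᶠ i in U, ∀ x ∈ A, (x ∈ liminf S U ↔ x ∈ S i) := by
    refine (eventually_all_finite hA).2 fun x _ => ?_
    rw [mem_liminf_iff_eventually_mem]
    by_cases hx : ∀ᶠ i in U, x ∈ S i
    · filter_upwards [hx] with i hi using iff_of_true hx hi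
    · filter_upwards [Ultrafilter.eventually_not.2 hx] with i hi using iff_of_false hx hi
  filter_upwards [hiff] with i hi
  ext x
  exact and_congr_right (hi x)

namespace Forcing

variable {P : Type*} [Preorder P]

/-- Two conditions are compatible if some condition is stronger than both. -/
def Compatible (p q : P) : Prop := ∃ r, p ≤ r ∧ q ≤ r

/-- A set `A` of conditions is Fréchet-linked if for every sequence in `A` some condition forces
that infinitely many of its terms lie in the generic filter; this is expressed by density: every
stronger condition is compatible with infinitely many terms. -/
def IsFrechetLinked (A : Set P) : Prop :=
  ∀ p : ℕ → P, (∀ n, p n ∈ A) → ∃ q, ∀ s, q ≤ s → ∃ᶠ n in atTop, Compatible s (p n)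

theorem mem.mono {g : Name P} {n m : ℕ} {p q : P} (h : mem g n m p) (hpq : p ≤ q) :
    mem g n m q :=
  fun r hqr => h r (hpq.trans hqr)

theorem IsFrechetLinked.exists_not_forces_le {A : Set P} (hA : IsFrechetLinked A) {g : Name P}
    {k : ℕ} {p : P} (hg : ex (fun j => mem g k j) p) :
    ∃ m : ℕ, ∀ r ∈ A, p ≤ r → ¬ all (fun j => imp (mem g k j) (ground (m ≤ j))) r := by
  by_contra! hunbounded
  choose q hqA hpq hforce using hunbounded
  obtain ⟨r, hr⟩ := hA q hqA
  obtain ⟨_, t, hrt, hqt⟩ := (hr r le_rfl).exists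
  obtain ⟨s, hts, j, hj⟩ := hg t ((hpq _).trans hqt)
  obtain ⟨m, ⟨u, hsu, hqu⟩, hjm⟩ :=
    ((hr s (hrt.trans hts)).and_eventually (eventually_gt_atTop j)).exists
  exact hjm.not_ge (hforce m j u hqu (hj.mono hsu))

theorem not_addsDominatingReal_of_isFrechetLinked {ι : Type*} [Countable ι] {A : ι → Set P}
    (hA : ∀ i, IsFrechetLinked (A i)) (hcover : ∀ p, ∃ i, p ∈ A i) : ¬ AddsDominatingReal P := by
  rintro ⟨p, g, hg, hdom⟩
  choose B hB using fun i k => (hA i).exists_not_forces_le (hg.1 k)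
  obtain ⟨f, hf⟩ := exists_forall_eventually_le B
  obtain ⟨r, hpr, N, hN⟩ := hdom f p le_rfl
  obtain ⟨i, hi⟩ := hcover r
  obtain ⟨k, hBk, hNk⟩ := ((hf i).and (eventually_ge_atTop N)).exists
  exact hB i k r hi hpr fun j s hrs hj => hBk.trans (hN k j s hrs ⟨hNk, hj⟩)

end Forcing

section Trees

variable {S T : Set (List ℕ)} {η ν : List ℕ}

theorem treeSuc_inter (S T : Set (List ℕ)) (η : List ℕ) :
    treeSuc (S ∩ T) η = treeSuc S η ∩ treeSuc T η := by
  ext ν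
  exact and_and_right

theorem treeSuc_eq_inter_of_subset (h : S ⊆ T) (η : List ℕ) :
    treeSuc S η = treeSuc T η ∩ S := by
  ext ν
  exact ⟨fun hν => ⟨⟨h hν.1, hν.2⟩, hν.1⟩, fun hν => ⟨hν.2, hν.1.2⟩⟩

theorem treeSuc_mono (h : S ⊆ T) (η : List ℕ) : treeSuc S η ⊆ treeSuc T η :=
  fun _ hν => ⟨h hν.1, hν.2⟩

theorem treeAbove_mono (h : S ⊆ T) (η : List ℕ) : treeAbove S η ⊆ treeAbove T η :=
  fun _ hν => ⟨h hν.1, hν.2⟩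

theorem treeSuc_treeAbove (T : Set (List ℕ)) (h : η <+: ν) :
    treeSuc (treeAbove T η) ν = treeSuc T ν := by
  ext ρ
  constructor
  · exact fun hρ => ⟨hρ.1.1, hρ.2⟩
  · rintro ⟨hρ, m, rfl⟩
    exact ⟨⟨hρ, Or.inr (h.trans (List.prefix_append _ _))⟩, m, rfl⟩

theorem eventually_treeSuc_liminf_eq {ι : Type*} (U : Ultrafilter ι) {S : ι → Set (List ℕ)}
    (hS : ∀ i, S i ⊆ T) (hη : (treeSuc T η).Finite) :
    ∀ᶠ i in U, treeSuc (liminf S U) η = treeSuc (S i) η := by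
  have hlim : liminf S U ⊆ T := liminf_le_of_frequently_le' (Frequently.of_forall hS)
  filter_upwards [eventually_inter_liminf_eq U S hη] with i hi
  rw [treeSuc_eq_inter_of_subset hlim, treeSuc_eq_inter_of_subset (hS i), hi]

namespace IsSubtree

theorem nil_mem (hT : IsSubtree T) : [] ∈ T :=
  let ⟨η, hη⟩ := hT.1
  hT.2 [] η ⟨η, rfl⟩ hη

protected theorem inter (hS : IsSubtree S) (hT : IsSubtree T) : IsSubtree (S ∩ T) :=
  ⟨⟨[], hS.nil_mem, hT.nil_mem⟩, fun _ _ h hν => ⟨hS.2 _ _ h hν.1, hT.2 _ _ h hν.2⟩⟩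

protected theorem treeAbove (hT : IsSubtree T) (η : List ℕ) :
    IsSubtree (treeAbove T η) := by
  refine ⟨⟨[], hT.nil_mem, Or.inl ⟨η, rfl⟩⟩, fun ρ ν hρν hν => ⟨hT.2 ρ ν hρν hν.1, ?_⟩⟩
  rcases hν.2 with hνη | hην
  · exact Or.inl (hρν.trans hνη)
  · exact List.prefix_or_prefix_of_prefix hρν hην

protected theorem liminf {ι : Type*} {F : Filter ι} {S : ι → Set (List ℕ)}
    (hS : ∀ i, IsSubtree (S i)) : IsSubtree (liminf S F) := by
  refine ⟨⟨[], ?_⟩, fun η ν h hν => ?_⟩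
  · exact mem_liminf_iff_eventually_mem.2 (Eventually.of_forall fun i => (hS i).nil_mem)
  · rw [mem_liminf_iff_eventually_mem] at hν ⊢
    exact hν.mono fun i hi => (hS i).2 η ν h hi

theorem isPerfectTree (hT : IsSubtree T)
    (hsplit : ∀ η ∈ T, ∃ ν, η <+: ν ∧ (treeSuc T ν).Nontrivial) : IsPerfectTree T := by
  refine ⟨hT, fun η hη => ?_⟩
  obtain ⟨ν, hην, _, ⟨hi, i, rfl⟩, _, ⟨hj, j, rfl⟩, hij⟩ := hsplit η hη
  exact ⟨_, hi, _, hj, hην.trans (List.prefix_append _ _), hην.trans (List.prefix_append _ _),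
    fun h => hij (h.eq_of_length (by simp)), fun h => hij (h.eq_of_length (by simp)).symm⟩

end IsSubtree

theorem IsPerfectTree.exists_le_length (hT : IsPerfectTree T) (L : ℕ) :
    ∃ η ∈ T, L ≤ η.length := by
  induction L with
  | zero => exact ⟨[], hT.1.nil_mem, Nat.zero_le _⟩
  | succ L ih =>
    obtain ⟨η, hη, hL⟩ := ih
    obtain ⟨ν, hν, ρ, -, hην, hηρ, hνρ, -⟩ := hT.2 η hη
    refine ⟨ν, hν, hL.trans_lt (hην.length_le.lt_of_ne fun hlen => hνρ ?_)⟩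
    rwa [← hην.eq_of_length hlen]

end Trees

namespace CreatureParam

variable {c : CreatureParam} {η : List ℕ} {a b : Set (List ℕ)} {k l : ℝ}

theorem treeSuc_eq_image (hη : η ∈ c.T) :
    treeSuc c.T η = (fun m : ℕ => η ++ [m]) '' Set.Iio (c.lam η) := by
  ext ν
  constructor
  · rintro ⟨hν, m, rfl⟩
    exact ⟨m, (c.lam_spec η hη m).1 hν, rfl⟩
  · rintro ⟨m, hm, rfl⟩
    exact ⟨(c.lam_spec η hη m).2 hm, m, rfl⟩

theorem finite_treeSuc (hη : η ∈ c.T) : (treeSuc c.T η).Finite :=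
  treeSuc_eq_image hη ▸ (Set.finite_Iio _).image _

theorem ncard_treeSuc (hη : η ∈ c.T) : (treeSuc c.T η).ncard = c.lam η := by
  rw [treeSuc_eq_image hη, Set.ncard_image_of_injective _ fun i j h => by simpa using h,
    Set.ncard_Iio_nat]

theorem two_le_lam (hη : η ∈ c.T) : 2 ≤ c.lam η := by
  have hmu : (1 : ℝ) ≤ c.mu η := (one_le_pow₀ (by simp)).trans (c.sq_le_mu η hη)
  exact_mod_cast hmu.trans_lt (c.mu_lt_lam η hη)

/-- `c.IsBig η k a` says that the norm at `η` of the set `a` of successors of `η` is at least `k`.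
Nonemptiness of `a` is included because `nor` carries no information about the empty set. -/
def IsBig (c : CreatureParam) (η : List ℕ) (k : ℝ) (a : Set (List ℕ)) : Prop :=
  a ⊆ treeSuc c.T η ∧ a.Nonempty ∧ k ≤ c.nor η a

namespace IsBig

theorem of_le (ha : c.IsBig η k a) (hlk : l ≤ k) : c.IsBig η l a :=
  ⟨ha.1, ha.2.1, hlk.trans ha.2.2⟩

theorem nontrivial (ha : c.IsBig η 1 a) (hη : η ∈ c.T) : a.Nontrivial := by
  obtain ⟨hsub, hne, hnor⟩ := ha
  have hlam : (2 : ℝ) ≤ c.lam η := by exact_mod_cast two_le_lam hη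
  have hhalf := c.half_lt η hη a hsub hne hnor
  rw [ncard_treeSuc hη, lt_div_iff₀ (by linarith)] at hhalf
  have hcard : 1 < a.ncard := by
    have : (1 : ℝ) < a.ncard := by linarith
    exact_mod_cast this
  exact (Set.one_lt_ncard_iff_nontrivial_and_finite.1 hcard).1

theorem inter (ha : c.IsBig η (k + 1 / c.mu η) a) (hb : c.IsBig η (k + 1 / c.mu η) b)
    (hη : η ∈ c.T) (hmu : 2 ≤ c.mu η) (hk : 0 < k) : c.IsBig η k (a ∩ b) := by
  have hab := c.co_big η hη k hk 2 two_pos (by exact_mod_cast hmu) ![a, b]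
    (Fin.forall_fin_two.2 ⟨ha, hb⟩)
  have hInter : ⋂ j, (![a, b] : Fin 2 → Set (List ℕ)) j = a ∩ b := by
    ext x
    simp only [Set.mem_iInter, Fin.forall_fin_two, Matrix.cons_val_zero, Matrix.cons_val_one,
      Set.mem_inter_iff]
  rw [hInter] at hab
  exact ⟨Set.inter_subset_left.trans ha.1, hab⟩

end IsBig

end CreatureParam

namespace QTwo

open CreatureParam Forcing

variable {c : CreatureParam} {η ν : List ℕ}

/-- The condition with trunk `η` and tree `S`, given the weakest lower bound on the norms that the
definition of `ℚ²_𝐧` allows, namely `n = lg(η) + 1`. -/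
def ofIsBig (η : List ℕ) (S : Set (List ℕ)) (hS : IsSubtree S) (hη : η ∈ S)
    (hsub : S ⊆ treeAbove c.T η)
    (hbig : ∀ ν ∈ S, η <+: ν → c.IsBig ν (1 + 1 / (η.length + 1)) (treeSuc S ν)) : QTwo c where
  trunk := η
  tree := S
  n := η.length + 1
  trunk_mem := hη
  perfect := by
    have hsplit : ∀ ν ∈ S, η <+: ν → (treeSuc S ν).Nontrivial := fun ν hν hην =>
      ((hbig ν hν hην).of_le (le_add_of_nonneg_right (by positivity))).nontrivial (hsub hν).1
    refine hS.isPerfectTree fun ν hν => ?_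
    rcases (hsub hν).2 with hνη | hην
    · exact ⟨η, hνη, hsplit η hη List.prefix_rfl⟩
    · exact ⟨ν, List.prefix_rfl, hsplit ν hν hην⟩
  tree_subset := hsub
  one_le := Nat.le_add_left 1 _
  n_le := le_rfl
  le_nor ν hν hην := by exact_mod_cast (hbig ν hν hην).2

theorem tree_subset_T (p : QTwo c) : p.tree ⊆ c.T :=
  fun _ hν => (p.tree_subset hν).1

theorem trunk_isPrefix (p : QTwo c) (hν : ν ∈ p.tree) (hlen : p.trunk.length ≤ ν.length) :
    p.trunk <+: ν := by
  rcases (p.tree_subset hν).2 with hνp | hpν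
  · exact (hνp.eq_of_length_le hlen).symm ▸ List.prefix_rfl
  · exact hpν

theorem isBig_treeSuc (p : QTwo c) (hν : ν ∈ p.tree) (hpν : p.trunk <+: ν) :
    c.IsBig ν (1 + 1 / (p.trunk.length + 1)) (treeSuc p.tree ν) := by
  obtain ⟨hne, hnor⟩ := p.le_nor ν hν hpν
  have hn : (0 : ℝ) < p.n := by exact_mod_cast p.one_le
  have hn' : (p.n : ℝ) ≤ p.trunk.length + 1 := by exact_mod_cast p.n_le
  have hbig : c.IsBig ν (1 + 1 / (p.n : ℝ)) (treeSuc p.tree ν) :=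
    ⟨treeSuc_mono p.tree_subset_T ν, hne, hnor⟩
  exact hbig.of_le (by gcongr)

/-- Passing to a trunk of length `L` lowers the required norm by at least the loss `1 / μ_ν` in
co-bigness, because `(L + 1)² ≤ μ_ν`. -/
theorem isBig_treeSuc_add_one_div_mu (p : QTwo c) {L : ℕ} (hν : ν ∈ p.tree)
    (hpL : p.trunk.length < L) (hLν : L ≤ ν.length) :
    c.IsBig ν (1 + 1 / (L + 1) + 1 / c.mu ν) (treeSuc p.tree ν) := by
  have hpL' : (p.trunk.length : ℝ) + 1 ≤ L := by exact_mod_cast hpL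
  have hL : (0 : ℝ) < L := by exact_mod_cast Nat.zero_lt_of_lt hpL
  have hmu : ((L : ℝ) + 1) ^ 2 ≤ c.mu ν :=
    le_trans (by gcongr) (c.sq_le_mu ν (p.tree_subset_T hν))
  refine (p.isBig_treeSuc hν (p.trunk_isPrefix hν (hpL.le.trans hLν))).of_le ?_
  calc 1 + 1 / ((L : ℝ) + 1) + 1 / c.mu ν
      ≤ 1 + (1 / ((L : ℝ) + 1) + 1 / ((L : ℝ) + 1) ^ 2) := by rw [add_assoc]; gcongr
    _ ≤ 1 + 1 / L := by gcongr; exact one_div_add_one_add_one_div_sq_le hL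
    _ ≤ 1 + 1 / (p.trunk.length + 1) := by gcongr

theorem compatible_of_mem_tree {p q : QTwo c} (hp : ν ∈ p.tree) (hq : ν ∈ q.tree)
    (hpν : p.trunk.length < ν.length) (hqν : q.trunk.length < ν.length) : Compatible p q := by
  have hsub : p.tree ∩ q.tree ⊆ c.T := Set.inter_subset_left.trans p.tree_subset_T
  refine ⟨ofIsBig ν (treeAbove (p.tree ∩ q.tree) ν) ((p.perfect.1.inter q.perfect.1).treeAbove ν)
    ⟨⟨hp, hq⟩, Or.inl List.prefix_rfl⟩ (treeAbove_mono hsub ν) fun ρ hρ hνρ => ?_,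
    fun _ hρ => hρ.1.1, fun _ hρ => hρ.1.2⟩
  have hlen : (ν.length : ℝ) ≤ ρ.length := by exact_mod_cast hνρ.length_le
  have hν : (1 : ℝ) ≤ ν.length := by exact_mod_cast Nat.one_le_of_lt hpν
  have hmu : 2 ≤ c.mu ρ := le_trans (by nlinarith) (c.sq_le_mu ρ (hsub hρ.1))
  rw [treeSuc_treeAbove _ hνρ, treeSuc_inter]
  exact (p.isBig_treeSuc_add_one_div_mu hρ.1.1 hpν hνρ.length_le).inter
    (q.isBig_treeSuc_add_one_div_mu hρ.1.2 hqν hνρ.length_le) (hsub hρ.1) hmu (by positivity)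

theorem isBig_treeSuc_liminf {ι : Type*} {U : Ultrafilter ι} {p : ι → QTwo c}
    (hp : ∀ i, (p i).trunk = η) (hν : ν ∈ liminf (fun i => (p i).tree) U) (hην : η <+: ν) :
    c.IsBig ν (1 + 1 / (η.length + 1)) (treeSuc (liminf (fun i => (p i).tree) U) ν) := by
  have hνp : ∀ᶠ i in U, ν ∈ (p i).tree := mem_liminf_iff_eventually_mem.1 hν
  have hνT : ν ∈ c.T := hνp.exists.elim fun i hi => (p i).tree_subset_T hi
  obtain ⟨i, hνi, hsuc⟩ := (hνp.and (eventually_treeSuc_liminf_eq U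
    (fun i => (p i).tree_subset_T) (finite_treeSuc hνT))).exists
  rw [hsuc, ← hp i]
  exact (p i).isBig_treeSuc hνi (hp i ▸ hην)

/-- The limit along an ultrafilter of a family of conditions with common trunk `η`: its tree
consists of the nodes that belong to almost all trees of the family. -/
def ultralimit {ι : Type*} (U : Ultrafilter ι) (p : ι → QTwo c) (hp : ∀ i, (p i).trunk = η) :
    QTwo c :=
  ofIsBig η (liminf (fun i => (p i).tree) U) (.liminf fun i => (p i).perfect.1)
    (mem_liminf_iff_eventually_mem.2 (Eventually.of_forall fun i => hp i ▸ (p i).trunk_mem))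
    (liminf_le_of_frequently_le' (Frequently.of_forall fun i => hp i ▸ (p i).tree_subset))
    fun _ => isBig_treeSuc_liminf hp

theorem eventually_compatible_of_ultralimit_le {ι : Type*} {U : Ultrafilter ι} {p : ι → QTwo c}
    (hp : ∀ i, (p i).trunk = η) {s : QTwo c} (hs : ultralimit U p hp ≤ s) :
    ∀ᶠ i in U, Compatible s (p i) := by
  obtain ⟨ν, hν, hlen⟩ := s.perfect.exists_le_length (max s.trunk.length η.length + 1)
  have hνp : ∀ᶠ i in U, ν ∈ (p i).tree := mem_liminf_iff_eventually_mem.1 (hs hν)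
  filter_upwards [hνp] with i hi
  exact compatible_of_mem_tree hν hi (by omega) (by rw [hp]; omega)

theorem isFrechetLinked_setOf_trunk_eq (c : CreatureParam) (η : List ℕ) :
    IsFrechetLinked {p : QTwo c | p.trunk = η} :=
  fun p hp => ⟨ultralimit (hyperfilter ℕ) p hp, fun _ hs =>
    (eventually_compatible_of_ultralimit_le hp hs).frequently.filter_mono
      Nat.hyperfilter_le_atTop⟩

end QTwo

theorem claim6 (c : CreatureParam) : ¬ Forcing.AddsDominatingReal (QTwo c) :=
  Forcing.not_addsDominatingReal_of_isFrechetLinked (QTwo.isFrechetLinked_setOf_trunk_eq c)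
    fun p => ⟨p.trunk, rfl⟩
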